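/- Let $d\ge 1$ and $1\le p,q\le\infty$, let $\Omega_d$ be the unit sphere of $\mathbb C^d$ and $S^{2d-1}$ the unit sphere of $\mathbb R^{2d}$ with its Lebesgue (surface) measure $\tau$. Let $\Upsilon:\Omega_d\to S^{2d-1}$, $\Upsilon(z)=(x_1,y_1,\dots,x_d,y_d)$ for $z_k=x_k+iy_k$, and equip $\Omega_d$ with the measure $\sigma(E)=\tau(\Upsilon(E))$. All $L^p$ spaces consist of complex-valued functions; $U_p$ and $\widetilde U_p$ denote the closed unit balls of $L^p(\Omega_d)$ and $L^p(S^{2d-1})$. Let $\mathcal H_k$ be the space of restrictions to $S^{2d-1}$ of the harmonic homogeneous polynomials of degree $k$ with complex coefficients, and $\mathcal H_{m,n}$ the space of restrictions to $\Omega_d$ of the polynomials in $z,\bar z$ that are homogeneous of degree $m$ in $z$ and of degree $n$ in $\bar z$ and lie in the kernel of $4\sum_j\partial^2/\partial z_j\partial\bar z_j$. For each of these spaces $H$, let $Z_w\in H$ be its zonal harmonic with pole $w$, i.e. $Y(w)=\int Y\,\overline{Z_w}$ for all $Y\in H$, and let $(\varphi* Z)(w)=\int\varphi\,\overline{Z_w}$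 for integrable $\varphi$; write $Z^{(k)}$, $Z^{(m,n)}$ for $H=\mathcal H_k$, $\mathcal H_{m,n}$. Let $\lambda:[0,\infty)\to\mathbb C$ be bounded. For $\varphi\in L^p(\Omega_d)$, $f\in L^q(\Omega_d)$ we write $f=\Lambda_*\varphi$ if $f\sim\sum_{m,n}\lambda(m+n)\,\varphi* Z^{(m,n)}$, that is, $f* Z^{(m,n)}=\lambda(m+n)\,\varphi* Z^{(m,n)}$ for all $m,n\ge0$; for $\varphi\in L^p(S^{2d-1})$, $f\in L^q(S^{2d-1})$ we write $f=\widetilde\Lambda\varphi$ if $f* Z^{(k)}=\lambda(k)\,\varphi* Z^{(k)}$ for all $k\ge0$. Such a multiplier is bounded from $L^p$ into $L^q$ if every $\varphi\in L^p$ has an image in $L^q$ and the norms in $L^q$ of the images of the unit ball of $L^p$ are bounded. For a subset $A$ of a complex Banach space $X$ with closed unit ball $B_X$, let $$d_n(A,X)=\inf_{X_n}\sup_{x\in A}\inf_{y\in X_n}\|x-y\|,\qquad \delta_n(A,X)=\inf_{P_n}\sup_{x\in A}\|x-P_nx\|,$$ $$d^n(A,X)=\inf_{L^n}\sup_{x\in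 A\cap L^n}\|x\|,\qquad b_n(A,X)=\sup_{X_{n+1}}\sup\{r\ge 0: rB_X\cap X_{n+1}\subseteq A\}$$ be the Kolmogorov, linear, Gelfand and Bernstein $n$-widths, where $X_j$ runs over the subspaces of dimension $j$, $P_n$ over the bounded linear operators on $X$ with range of dimension $n$, and $L^n$ over the closed subspaces of codimension $n$. Suppose that $\Lambda_*$ is bounded from $L^p(\Omega_d)$ into $L^q(\Omega_d)$. Then $\widetilde\Lambda$ is bounded from $L^p(S^{2d-1})$ into $L^q(S^{2d-1})$, $$\Lambda_*\varphi=\bigl(\widetilde\Lambda(\varphi\circ\Upsilon^{-1})\bigr)\circ\Upsilon\qquad(\varphi\in L^p(\Omega_d)),$$ and for every integer $n\ge0$ the Kolmogorov, Gelfand, linear and Bernstein widths agree: $$d_n(\Lambda_*U_p,L^q(\Omega_d))=d_n(\widetilde\Lambda\widetilde U_p,L^q(S^{2d-1})),\qquad d^n(\Lambda_*U_p,L^q(\Omega_d))=d^n(\widetilde\Lambda\widetilde U_p,L^q(S^{2d-1})),$$ $$\delta_n(\Lambda_*U_p,L^q(\Omega_d))=\delta_n(\widetilde\Lambda\widetilde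 U_p,L^q(S^{2d-1})),\qquad b_n(\Lambda_*U_p,L^q(\Omega_d))=b_n(\widetilde\Lambda\widetilde U_p,L^q(S^{2d-1})).$$ The equality for $d^n$ also holds if $L^n$ runs over all subspaces of codimension $n$, closed or not. -/

import Mathlib

open MeasureTheory
open scoped ENNReal NNReal

noncomputable section

namespace SphereWidths

/-! ### `n`-widths of a subset `A` of a complex normed space `X`, with values in `[0, ∞]` -/

section Widths

variable {X : Type*} [NormedAddCommGroup X] [NormedSpace ℂ X]

/-- Kolmogorov `n`-width `d_n(A, X)`. -/
def kolmogorovWidth (n : ℕ) (A : Set X) : ℝ≥0∞ :=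
  ⨅ (V : Submodule ℂ X) (_ : Module.rank ℂ V = n), ⨆ x ∈ A, ⨅ y ∈ V, ‖x - y‖ₑ

/-- Linear `n`-width `δ_n(A, X)`. -/
def linearWidth (n : ℕ) (A : Set X) : ℝ≥0∞ :=
  ⨅ (P : X →L[ℂ] X) (_ : (P : X →ₗ[ℂ] X).rank = n), ⨆ x ∈ A, ‖x - P x‖ₑ

/-- Gelfand `n`-width `d^n(A, X)`, over the closed subspaces of codimension `n`. -/
def gelfandWidth (n : ℕ) (A : Set X) : ℝ≥0∞ :=
  ⨅ (L : Submodule ℂ X) (_ : IsClosed (L : Set X)) (_ : Module.rank ℂ (X ⧸ L) = n),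
    ⨆ x ∈ A ∩ (L : Set X), ‖x‖ₑ

/-- The variant of the Gelfand `n`-width in which the subspaces of codimension `n` need not be
closed. -/
def gelfandWidthAll (n : ℕ) (A : Set X) : ℝ≥0∞ :=
  ⨅ (L : Submodule ℂ X) (_ : Module.rank ℂ (X ⧸ L) = n), ⨆ x ∈ A ∩ (L : Set X), ‖x‖ₑ

/-- Bernstein `n`-width `b_n(A, X)`: here `r B_X ∩ V = {x ∈ V : ‖x‖ ≤ r}`. -/
def bernsteinWidth (n : ℕ) (A : Set X) : ℝ≥0∞ :=
  ⨆ (V : Submodule ℂ X) (_ : Module.rank ℂ V = (n + 1 : ℕ))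
    (r : ℝ≥0) (_ : Metric.closedBall (0 : X) r ∩ (V : Set X) ⊆ A), (r : ℝ≥0∞)

end Widths

/-! ### Zonal kernels, convolutions and multipliers

`H i` is a family of finite dimensional spaces of continuous functions on a compact space `S`
with a finite measure `μ`; it will be the family of the `𝓗_k` on the real sphere and the family of
the `𝓗_{m,n}` on the complex sphere. -/

section Multipliers

variable {S : Type*} [TopologicalSpace S] [CompactSpace S] [MeasurableSpace S] [BorelSpace S]
  (μ : Measure S) [IsFiniteMeasure μ] [μ.IsOpenPosMeasure]

theorem exists_zonal (H : Submodule ℂ C(S, ℂ)) [FiniteDimensional ℂ H] (w : S) :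
    ∃ Z ∈ H, ∀ Y ∈ H, ∫ z, Y z * starRingEnd ℂ (Z z) ∂μ = Y w := by
  let J : H →ₗ[ℂ] Lp ℂ 2 μ :=
    (ContinuousMap.toLp (E := ℂ) 2 μ ℂ : C(S, ℂ) →ₗ[ℂ] Lp ℂ 2 μ) ∘ₗ H.subtype
  have hJ : Function.Injective J :=
    (ContinuousMap.toLp_injective (E := ℂ) (p := 2) (𝕜 := ℂ) μ).comp Subtype.val_injective
  let e : H ≃ₗ[ℂ] LinearMap.range J := LinearEquiv.ofInjective J hJ
  let ev : LinearMap.range J →ₗ[ℂ] ℂ :=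
    ((ContinuousMap.evalCLM ℂ w : C(S, ℂ) →L[ℂ] ℂ) : C(S, ℂ) →ₗ[ℂ] ℂ) ∘ₗ H.subtype ∘ₗ
      (e.symm : LinearMap.range J →ₗ[ℂ] H)
  have : CompleteSpace (LinearMap.range J) := FiniteDimensional.complete ℂ _
  let k := (InnerProductSpace.toDual ℂ (LinearMap.range J)).symm (LinearMap.toContinuousLinearMap ev)
  refine ⟨e.symm k, (e.symm k).2, fun Y hY => ?_⟩
  have h1 : inner ℂ k (e ⟨Y, hY⟩) = Y w := by
    rw [InnerProductSpace.toDual_symm_apply]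
    simp [ev]
  rw [← h1, Submodule.coe_inner, MeasureTheory.L2.inner_def]
  have hk : (k : Lp ℂ 2 μ) = ContinuousMap.toLp (E := ℂ) 2 μ ℂ (e.symm k : C(S, ℂ)) := by
    conv_lhs => rw [← e.apply_symm_apply k]
    rfl
  have hY' : ((e ⟨Y, hY⟩ : LinearMap.range J) : Lp ℂ 2 μ) = ContinuousMap.toLp (E := ℂ) 2 μ ℂ Y :=
    rfl
  rw [hk, hY']
  refine integral_congr_ae ?_
  filter_upwards [ContinuousMap.coeFn_toLp (p := 2) (𝕜 := ℂ) μ Y,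
    ContinuousMap.coeFn_toLp (p := 2) (𝕜 := ℂ) μ (e.symm k : C(S, ℂ))] with z hz1 hz2
  rw [hz1, hz2, RCLike.inner_apply]

/-- The zonal element `Z_w ∈ H` with pole `w`: the reproducing kernel of `H ⊆ L²(μ)` at `w`. -/
def zonal (H : Submodule ℂ C(S, ℂ)) [FiniteDimensional ℂ H] (w : S) : C(S, ℂ) :=
  (exists_zonal μ H w).choose

theorem zonal_mem (H : Submodule ℂ C(S, ℂ)) [FiniteDimensional ℂ H] (w : S) :
    zonal μ H w ∈ H :=
  (exists_zonal μ H w).choose_spec.1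

theorem integral_mul_conj_zonal (H : Submodule ℂ C(S, ℂ)) [FiniteDimensional ℂ H] (w : S)
    (Y : C(S, ℂ)) (hY : Y ∈ H) : ∫ z, Y z * starRingEnd ℂ (zonal μ H w z) ∂μ = Y w :=
  (exists_zonal μ H w).choose_spec.2 Y hY

/-- The convolution of `φ` with the zonal kernel of `H`: `w ↦ ∫ φ(z) conj(Z_w(z)) dμ(z)`. -/
def zonalConv (H : Submodule ℂ C(S, ℂ)) [FiniteDimensional ℂ H] (φ : S → ℂ) (w : S) : ℂ :=
  ∫ z, φ z * starRingEnd ℂ (zonal μ H w z) ∂μ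

variable {ι : Type*} (H : ι → Submodule ℂ C(S, ℂ)) [∀ i, FiniteDimensional ℂ (H i)]
  (lam : ι → ℂ) (p q : ℝ≥0∞)

/-- `f = Λ φ`, where `Λ` is the multiplier with sequence `lam`: the component of `f` in each `H i`
is `lam i` times that of `φ`, that is, `f` has the formal expansion `∑ i, lam i • (φ ∗ Z^(i))`. -/
def IsMultiplierImage (φ : Lp ℂ p μ) (f : Lp ℂ q μ) : Prop :=
  ∀ i w, zonalConv μ (H i) f w = lam i * zonalConv μ (H i) φ w

/-- The set `Λ U_p` of all `Λ φ ∈ L^q` with `φ` in the closed unit ball of `L^p`. -/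
def multiplierBall : Set (Lp ℂ q μ) :=
  {f | ∃ φ : Lp ℂ p μ, ‖φ‖ ≤ 1 ∧ IsMultiplierImage μ H lam p q φ f}

/-- The multiplier operator with sequence `lam` is bounded from `L^p` into `L^q`: every `φ ∈ L^p`
has an image `Λ φ ∈ L^q`, and `sup {‖Λ φ‖_q : φ ∈ U_p} < ∞`. -/
def IsBoundedMultiplier : Prop :=
  (∀ φ : Lp ℂ p μ, ∃ f : Lp ℂ q μ, IsMultiplierImage μ H lam p q φ f) ∧
    BddAbove (norm '' multiplierBall μ H lam p q)

end Multipliers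

/-! ### The real sphere `S^{N-1}` in `ℝ^N` -/

/-- The unit sphere `S^{N-1}` of `ℝ^N`. -/
abbrev RSphere (N : ℕ) : Type := Metric.sphere (0 : EuclideanSpace ℝ (Fin N)) 1

/-- The Lebesgue (surface) measure `τ_N` on `S^{N-1}`. -/
abbrev τ (N : ℕ) : Measure (RSphere N) := (volume : Measure (EuclideanSpace ℝ (Fin N))).toSphere

/-- Restriction to `S^{N-1}` of a polynomial in `x_1, …, x_N` with complex coefficients. -/
def realRestrict (N : ℕ) : MvPolynomial (Fin N) ℂ →ₐ[ℂ] C(RSphere N, ℂ) :=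
  MvPolynomial.aeval fun i => ⟨fun x => ((x.1 i : ℝ) : ℂ), by fun_prop⟩

/-- The Laplacian `∑ ∂²/∂x_i²` on polynomials. -/
def realLaplacian (N : ℕ) : MvPolynomial (Fin N) ℂ →ₗ[ℂ] MvPolynomial (Fin N) ℂ :=
  ∑ i, (MvPolynomial.pderiv i).toLinearMap ∘ₗ (MvPolynomial.pderiv i).toLinearMap

/-- `𝓗_k`: the spherical harmonics of degree `k` on `S^{N-1}`. -/
def realHarmonics (N k : ℕ) : Submodule ℂ C(RSphere N, ℂ) :=
  (MvPolynomial.homogeneousSubmodule (Fin N) ℂ k ⊓ LinearMap.ker (realLaplacian N)).map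
    (realRestrict N).toLinearMap

instance (N k : ℕ) : FiniteDimensional ℂ (realHarmonics N k) := by
  have h : (MvPolynomial.homogeneousSubmodule (Fin N) ℂ k ⊓ LinearMap.ker (realLaplacian N)) ≤
      MvPolynomial.restrictTotalDegree (Fin N) ℂ k := fun P hP =>
    (MvPolynomial.mem_restrictTotalDegree _ _ _).2
      (MvPolynomial.IsHomogeneous.totalDegree_le
        ((MvPolynomial.mem_homogeneousSubmodule k P).1 hP.1))
  have := Submodule.finiteDimensional_of_le h
  unfold realHarmonics
  infer_instance

/-! ### The complex sphere `Ω_d` in `ℂ^d` -/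

/-- The unit sphere `Ω_d` of `ℂ^d`. -/
abbrev CSphere (d : ℕ) : Type := Metric.sphere (0 : EuclideanSpace ℂ (Fin d)) 1

/-- The map `ℂ^d → ℝ^{2d}`, `z ↦ (x_1, y_1, …, x_d, y_d)` with `z_k = x_k + i y_k`
(`finProdFinEquiv (k, b)` is the index `2 k + b`, where all indices start from `0`). -/
def upsilonBar (d : ℕ) : EuclideanSpace ℂ (Fin d) ≃ₗᵢ[ℝ] EuclideanSpace ℝ (Fin (d * 2)) where
  toFun z := WithLp.toLp 2 fun j =>
    ![(z (finProdFinEquiv.symm j).1).re, (z (finProdFinEquiv.symm j).1).im]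
      (finProdFinEquiv.symm j).2
  invFun x := WithLp.toLp 2 fun k => ⟨x (finProdFinEquiv (k, 0)), x (finProdFinEquiv (k, 1))⟩
  map_add' z w := by
    ext j
    obtain ⟨⟨k, b⟩, rfl⟩ := finProdFinEquiv.surjective j
    fin_cases b <;> simp [-finProdFinEquiv_symm_apply, -finProdFinEquiv_apply_val]
  map_smul' c z := by
    ext j
    obtain ⟨⟨k, b⟩, rfl⟩ := finProdFinEquiv.surjective j
    fin_cases b <;> simp [-finProdFinEquiv_symm_apply, -finProdFinEquiv_apply_val]
  left_inv z := by
    ext k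
    simp [-finProdFinEquiv_symm_apply, -finProdFinEquiv_apply_val]
  right_inv x := by
    ext j
    obtain ⟨⟨k, b⟩, rfl⟩ := finProdFinEquiv.surjective j
    fin_cases b <;> simp [-finProdFinEquiv_symm_apply, -finProdFinEquiv_apply_val]
  norm_map' z := by
    rw [EuclideanSpace.norm_eq, EuclideanSpace.norm_eq, ← finProdFinEquiv.sum_comp,
      Fintype.sum_prod_type]
    congr 1
    refine Finset.sum_congr rfl fun k _ => ?_
    rw [Complex.sq_norm, Complex.normSq_apply]
    simp [-finProdFinEquiv_symm_apply, -finProdFinEquiv_apply_val, Fin.sum_univ_two, sq]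

/-- The restriction `Υ : Ω_d → S^{2d-1}` of `upsilonBar`, a homeomorphism. -/
def upsilon (d : ℕ) : CSphere d ≃ₜ RSphere (d * 2) :=
  (upsilonBar d).toHomeomorph.subtype fun z => by simp

/-- The measure `σ_d` on `Ω_d`: `σ_d(E) = τ_{2d}(Υ(E))`. -/
def σ (d : ℕ) : Measure (CSphere d) := (τ (d * 2)).comap (upsilon d)

theorem measurableEmbedding_upsilon (d : ℕ) : MeasurableEmbedding (upsilon d) :=
  (upsilon d).measurableEmbedding

theorem measurePreserving_upsilon (d : ℕ) : MeasurePreserving (upsilon d) (σ d) (τ (d * 2)) := by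
  refine ⟨(upsilon d).continuous.measurable, ?_⟩
  rw [σ, (measurableEmbedding_upsilon d).map_comap]
  simp [(upsilon d).surjective.range_eq]

theorem measurePreserving_upsilon_symm (d : ℕ) :
    MeasurePreserving (upsilon d).symm (τ (d * 2)) (σ d) :=
  (measurePreserving_upsilon d).symm (upsilon d).toMeasurableEquiv

theorem σ_eq_map (d : ℕ) : σ d = (τ (d * 2)).map (upsilon d).symm :=
  (measurePreserving_upsilon_symm d).map_eq.symm

instance (d : ℕ) : IsFiniteMeasure (σ d) := by
  rw [σ_eq_map]
  infer_instance

instance (d : ℕ) : (σ d).IsOpenPosMeasure := by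
  rw [σ_eq_map]
  exact (upsilon d).symm.continuous.isOpenPosMeasure_map (upsilon d).symm.surjective

/-- Restriction to `Ω_d` of a polynomial in `z` (the variables `Sum.inl j`) and `conj z`
(the variables `Sum.inr j`). -/
def complexRestrict (d : ℕ) : MvPolynomial (Fin d ⊕ Fin d) ℂ →ₐ[ℂ] C(CSphere d, ℂ) :=
  MvPolynomial.aeval <| Sum.elim (fun j => ⟨fun z => z.1 j, by fun_prop⟩)
    (fun j => ⟨fun z => starRingEnd ℂ (z.1 j), by fun_prop⟩)

/-- The complex Laplacian `4 ∑ ∂²/∂z_j ∂(conj z_j)` on polynomials in `z` and `conj z`. -/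
def complexLaplacian (d : ℕ) :
    MvPolynomial (Fin d ⊕ Fin d) ℂ →ₗ[ℂ] MvPolynomial (Fin d ⊕ Fin d) ℂ :=
  (4 : ℂ) • ∑ j, (MvPolynomial.pderiv (Sum.inl j)).toLinearMap ∘ₗ
    (MvPolynomial.pderiv (Sum.inr j)).toLinearMap

/-- Polynomials homogeneous of degree `m` in `z` and homogeneous of degree `n` in `conj z`. -/
def bihomogeneous (d m n : ℕ) : Submodule ℂ (MvPolynomial (Fin d ⊕ Fin d) ℂ) :=
  MvPolynomial.weightedHomogeneousSubmodule ℂ (Sum.elim (fun _ => 1) (fun _ => 0) : _ → ℕ) m ⊓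
    MvPolynomial.weightedHomogeneousSubmodule ℂ (Sum.elim (fun _ => 0) (fun _ => 1) : _ → ℕ) n

/-- `𝓗_{m,n}`: the complex spherical harmonics of bidegree `(m, n)` on `Ω_d`,
where `mn = (m, n)`. -/
def complexHarmonics (d : ℕ) (mn : ℕ × ℕ) : Submodule ℂ C(CSphere d, ℂ) :=
  (bihomogeneous d mn.1 mn.2 ⊓ LinearMap.ker (complexLaplacian d)).map
    (complexRestrict d).toLinearMap

theorem bihomogeneous_le (d m n : ℕ) :
    bihomogeneous d m n ≤ MvPolynomial.restrictTotalDegree (Fin d ⊕ Fin d) ℂ (m + n) := by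
  intro P hP
  rw [MvPolynomial.mem_restrictTotalDegree, MvPolynomial.totalDegree]
  refine Finset.sup_le fun a ha => ?_
  have hm := hP.1 (MvPolynomial.mem_support_iff.1 ha)
  have hn := hP.2 (MvPolynomial.mem_support_iff.1 ha)
  rw [Finsupp.weight_apply, Finsupp.sum_fintype _ _ (by simp)] at hm hn
  rw [Finsupp.sum_fintype _ _ (by simp), ← hm, ← hn]
  simp

instance (d : ℕ) (mn : ℕ × ℕ) : FiniteDimensional ℂ (complexHarmonics d mn) := by
  have := Submodule.finiteDimensional_of_le ((inf_le_left :
    bihomogeneous d mn.1 mn.2 ⊓ LinearMap.ker (complexLaplacian d) ≤ _).trans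
      (bihomogeneous_le d mn.1 mn.2))
  unfold complexHarmonics
  infer_instance

/-! ### The two multiplier sequences -/

/-- The sequence `Λ_*`: `λ*_{m,n} = λ(m + n)`. -/
def lamStar (lam : ℝ≥0 → ℂ) (mn : ℕ × ℕ) : ℂ := lam ((mn.1 + mn.2 : ℕ) : ℝ≥0)

/-- The sequence of the multiplier on the real sphere: `λ_k = λ(k)`. -/
def lamReal (lam : ℝ≥0 → ℂ) (k : ℕ) : ℂ := lam (k : ℝ≥0)

/-- `Λ_* U_p(Ω_d)` as a subset of `L^q(Ω_d)`. -/
def complexMultiplierBall (d : ℕ) (lam : ℝ≥0 → ℂ) (p q : ℝ≥0∞) : Set (Lp ℂ q (σ d)) :=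
  multiplierBall (σ d) (complexHarmonics d) (lamStar lam) p q

/-- The image of the unit ball of `L^p(S^{2d-1})` under the multiplier with sequence `λ(k)`,
as a subset of `L^q(S^{2d-1})`. -/
def realMultiplierBall (d : ℕ) (lam : ℝ≥0 → ℂ) (p q : ℝ≥0∞) : Set (Lp ℂ q (τ (d * 2))) :=
  multiplierBall (τ (d * 2)) (realHarmonics (d * 2)) (lamReal lam) p q

end SphereWidths

end

open SphereWidths

/-!
The multiplier relation `f = Λ φ` can be tested by integration. The zonal functions `Z_w`, `w ∈ S`,
span `H` (an element of `H` orthogonal to all of them vanishes at every point `w`), so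
`f ∗ Z = c (φ ∗ Z)` on `S` holds if and only if `∫ f · conj Y = c ∫ φ · conj Y` for every `Y ∈ H`
(`isMultiplierImage_iff_le_testSubmodule`). This condition is linear in `Y`, hence it passes to
sums of spaces.

Written in the coordinates `z, conj z`, a homogeneous harmonic polynomial of degree `k` is the sum
of its bihomogeneous components of bidegrees `(m, n)` with `m + n = k`. As the Laplacian lowers the
bidegree by `(1, 1)`, all of them are harmonic. So `𝓗_k ∘ Υ` is the sum of the `𝓗_{m,n}` with
`m + n = k` (`map_realHarmonics`). Since the sequence `λ(m + n)` depends on `m + n` alone, the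
isometric isomorphism `f ↦ f ∘ Υ⁻¹` of the `L^p` spaces carries the relation `f = Λ_* φ` to the
relation defined by the multiplier on the real sphere (`isMultiplierImage_lpUpsilon_iff`), and the
set `Λ_* U_p` onto its counterpart there (`image_complexMultiplierBall`). The `n`-widths are
invariant under isometric isomorphisms.
-/

noncomputable section

namespace SphereWidths

/-! ### Zonal functions and multipliers -/

section Multipliers

theorem integrable_mul_conj {S : Type*} [TopologicalSpace S] [CompactSpace S] [MeasurableSpace S]
    [BorelSpace S] {μ : Measure S} {g : S → ℂ}
    (hg : Integrable g μ) (Y : C(S, ℂ)) :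
    Integrable (fun z => g z * starRingEnd ℂ (Y z)) μ := by
  refine hg.mul_bdd (c := ‖Y‖) (by fun_prop) (.of_forall fun z => ?_)
  simpa using Y.norm_coe_le_norm z

variable {S : Type*} [TopologicalSpace S] [CompactSpace S] [MeasurableSpace S] [BorelSpace S]
  (μ : Measure S) [IsFiniteMeasure μ] [μ.IsOpenPosMeasure]

/-- A `Y ∈ H` orthogonal to all zonal elements vanishes, since its scalar product with `Z_w` is
`Y(w)`. -/
theorem span_range_zonal (H : Submodule ℂ C(S, ℂ)) [FiniteDimensional ℂ H] :
    Submodule.span ℂ (Set.range (zonal μ H)) = H := by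
  set K := Submodule.span ℂ (Set.range (zonal μ H)) with hK
  have hKH : K ≤ H := Submodule.span_le.2 (by rintro _ ⟨w, rfl⟩; exact zonal_mem μ H w)
  let J : C(S, ℂ) →ₗ[ℂ] Lp ℂ 2 μ := (ContinuousMap.toLp (E := ℂ) 2 μ ℂ : C(S, ℂ) →ₗ[ℂ] Lp ℂ 2 μ)
  have hJ : Function.Injective J := ContinuousMap.toLp_injective (E := ℂ) (p := 2) (𝕜 := ℂ) μ
  refine Submodule.map_injective_of_injective hJ ?_
  have : FiniteDimensional ℂ K := Submodule.finiteDimensional_of_le hKH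
  have hsup := Submodule.sup_orthogonal_inf_of_hasOrthogonalProjection
    (Submodule.map_mono (f := J) hKH)
  suffices h : (K.map J)ᗮ ⊓ H.map J = ⊥ by rwa [h, sup_bot_eq] at hsup
  rw [Submodule.eq_bot_iff]
  rintro _ ⟨hY, Y, hYH, rfl⟩
  suffices h : Y = 0 by rw [h, map_zero]
  ext w
  rw [← integral_mul_conj_zonal μ H w Y hYH, ContinuousMap.zero_apply,
    ← hY (J (zonal μ H w)) ⟨_, Submodule.subset_span ⟨w, rfl⟩, rfl⟩, L2.inner_def]
  refine integral_congr_ae ?_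
  filter_upwards [ContinuousMap.coeFn_toLp (p := 2) (𝕜 := ℂ) μ Y,
    ContinuousMap.coeFn_toLp (p := 2) (𝕜 := ℂ) μ (zonal μ H w)] with z hz1 hz2
  change _ = inner ℂ ((ContinuousMap.toLp (E := ℂ) 2 μ ℂ (zonal μ H w)) z)
    ((ContinuousMap.toLp (E := ℂ) 2 μ ℂ Y) z)
  rw [hz1, hz2, RCLike.inner_apply]

variable {μ} in
/-- The functions `Y` against which `f` and `c • φ` have the same integral
`∫ f · conj Y = c ∫ φ · conj Y`. -/
def testSubmodule (c : ℂ) {φ f : S → ℂ} (hφ : Integrable φ μ) (hf : Integrable f μ) :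
    Submodule ℂ C(S, ℂ) where
  carrier := {Y | ∫ z, f z * starRingEnd ℂ (Y z) ∂μ = c * ∫ z, φ z * starRingEnd ℂ (Y z) ∂μ}
  zero_mem' := by simp
  add_mem' {Y Y'} hY hY' := by
    simp only [Set.mem_ofPred_eq, ContinuousMap.add_apply, map_add, mul_add] at hY hY' ⊢
    rw [integral_add (integrable_mul_conj hf Y) (integrable_mul_conj hf Y'),
      integral_add (integrable_mul_conj hφ Y) (integrable_mul_conj hφ Y'), hY, hY', mul_add]
  smul_mem' a Y hY := by
    simp only [Set.mem_ofPred_eq, ContinuousMap.smul_apply, smul_eq_mul, map_mul,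
      mul_left_comm _ (starRingEnd ℂ a), integral_const_mul] at hY ⊢
    rw [hY, mul_left_comm]

/-- A multiplier image can be tested on all of each `H i` instead of on its zonal elements only,
because these span `H i`. -/
theorem isMultiplierImage_iff_le_testSubmodule {ι : Type*} (H : ι → Submodule ℂ C(S, ℂ))
    [∀ i, FiniteDimensional ℂ (H i)] (lam : ι → ℂ) {p q : ℝ≥0∞} [hp : Fact (1 ≤ p)]
    [hq : Fact (1 ≤ q)] (φ : Lp ℂ p μ) (f : Lp ℂ q μ) :
    IsMultiplierImage μ H lam p q φ f ↔ ∀ i, H i ≤ testSubmodule (lam i)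
      ((Lp.memLp φ).integrable hp.out) ((Lp.memLp f).integrable hq.out) := by
  refine forall_congr' fun i => ?_
  conv_rhs => rw [← span_range_zonal μ (H i), Submodule.span_le, Set.range_subset_iff]
  rfl

end Multipliers

/-! ### Invariance of the `n`-widths under isometric isomorphisms -/

section Widths

universe u

variable {X Y : Type u} [NormedAddCommGroup X] [NormedSpace ℂ X] [NormedAddCommGroup Y]
  [NormedSpace ℂ Y]

theorem kolmogorovWidth_image_le (e : X ≃ₗᵢ[ℂ] Y) (n : ℕ) (A : Set X) :
    kolmogorovWidth n (e '' A) ≤ kolmogorovWidth n A := by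
  refine le_iInf₂ fun V hV => ?_
  refine (iInf₂_le (V.map (e.toLinearEquiv : X →ₗ[ℂ] Y))
    ((e.toLinearEquiv.submoduleMap V).rank_eq.symm.trans hV)).trans ?_
  simp only [Set.mem_image, iSup_exists, iSup_and, iSup_le_iff]
  rintro _ x hx rfl
  refine le_iSup₂_of_le x hx (le_iInf₂ fun y hy => ?_)
  refine (iInf₂_le (e y) (Submodule.mem_map_of_mem hy)).trans ?_
  rw [← map_sub, e.enorm_map]

theorem linearWidth_image_le (e : X ≃ₗᵢ[ℂ] Y) (n : ℕ) (A : Set X) :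
    linearWidth n (e '' A) ≤ linearWidth n A := by
  refine le_iInf₂ fun P hP => ?_
  let E : X ≃L[ℂ] Y := e.toContinuousLinearEquiv
  refine (iInf₂_le ((E : X →L[ℂ] Y) ∘L P ∘L (E.symm : Y →L[ℂ] X)) ?_).trans ?_
  · rw [← hP, LinearMap.rank, LinearMap.rank]
    have : LinearMap.range (((E : X →L[ℂ] Y) ∘L P ∘L (E.symm : Y →L[ℂ] X) : Y →L[ℂ] Y) :
        Y →ₗ[ℂ] Y) = (LinearMap.range (P : X →ₗ[ℂ] X)).map (E.toLinearEquiv : X →ₗ[ℂ] Y) := by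
      ext y
      constructor
      · rintro ⟨z, rfl⟩
        exact ⟨P (E.symm z), ⟨_, rfl⟩, rfl⟩
      · rintro ⟨_, ⟨z, rfl⟩, rfl⟩
        exact ⟨E z, by simp⟩
    rw [this]
    exact (E.toLinearEquiv.submoduleMap _).rank_eq.symm
  · simp only [Set.mem_image, iSup_exists, iSup_and, iSup_le_iff]
    rintro _ x hx rfl
    refine le_iSup₂_of_le x hx ?_
    have : e x - ((E : X →L[ℂ] Y) ∘L P ∘L (E.symm : Y →L[ℂ] X)) (e x) = e (x - P x) := by
      simp [E]
    rw [this, e.enorm_map]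

theorem rank_quotient_map (e : X ≃ₗᵢ[ℂ] Y) (L : Submodule ℂ X) :
    Module.rank ℂ (Y ⧸ L.map (e.toLinearEquiv : X →ₗ[ℂ] Y)) = Module.rank ℂ (X ⧸ L) :=
  (Submodule.Quotient.equiv L _ e.toLinearEquiv rfl).rank_eq.symm

theorem iSup_enorm_image_inter_map (e : X ≃ₗᵢ[ℂ] Y) (A : Set X) (L : Submodule ℂ X) :
    ⨆ y ∈ e '' A ∩ (L.map (e.toLinearEquiv : X →ₗ[ℂ] Y) : Set Y), ‖y‖ₑ =
      ⨆ x ∈ A ∩ (L : Set X), ‖x‖ₑ := by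
  have : e '' A ∩ (L.map (e.toLinearEquiv : X →ₗ[ℂ] Y) : Set Y) = e '' (A ∩ (L : Set X)) :=
    (Set.image_inter e.injective).symm
  rw [this, iSup_image]
  simp only [e.enorm_map]

theorem gelfandWidthAll_image_le (e : X ≃ₗᵢ[ℂ] Y) (n : ℕ) (A : Set X) :
    gelfandWidthAll n (e '' A) ≤ gelfandWidthAll n A :=
  le_iInf₂ fun L hL => (iInf₂_le (L.map (e.toLinearEquiv : X →ₗ[ℂ] Y))
    ((rank_quotient_map e L).trans hL)).trans (iSup_enorm_image_inter_map e A L).le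

theorem gelfandWidth_image_le (e : X ≃ₗᵢ[ℂ] Y) (n : ℕ) (A : Set X) :
    gelfandWidth n (e '' A) ≤ gelfandWidth n A :=
  le_iInf fun L => le_iInf₂ fun hc hL => (iInf_le_of_le (L.map (e.toLinearEquiv : X →ₗ[ℂ] Y))
    (iInf₂_le (e.toHomeomorph.isClosedMap _ hc)
    ((rank_quotient_map e L).trans hL))).trans (iSup_enorm_image_inter_map e A L).le

theorem le_bernsteinWidth_image (e : X ≃ₗᵢ[ℂ] Y) (n : ℕ) (A : Set X) :
    bernsteinWidth n A ≤ bernsteinWidth n (e '' A) := by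
  refine iSup₂_le fun V hV => iSup₂_le fun r hr => ?_
  refine le_iSup₂_of_le (V.map (e.toLinearEquiv : X →ₗ[ℂ] Y))
    ((e.toLinearEquiv.submoduleMap V).rank_eq.symm.trans hV) (le_iSup₂_of_le r ?_ le_rfl)
  rintro _ ⟨hx, x, hxV, rfl⟩
  refine ⟨x, hr ⟨?_, hxV⟩, rfl⟩
  simpa using hx

/-- A set function that does not increase under isometric isomorphisms is invariant under them:
apply the inequality to the inverse isomorphism. -/
theorem image_eq_of_image_le {F : ∀ {Z : Type u} [NormedAddCommGroup Z] [NormedSpace ℂ Z],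
      Set Z → ℝ≥0∞}
    (hF : ∀ {X Y : Type u} [NormedAddCommGroup X] [NormedSpace ℂ X] [NormedAddCommGroup Y]
      [NormedSpace ℂ Y] (e : X ≃ₗᵢ[ℂ] Y) (A : Set X), F (e '' A) ≤ F A)
    (e : X ≃ₗᵢ[ℂ] Y) (A : Set X) : F (e '' A) = F A := by
  refine (hF e A).antisymm ?_
  have := hF e.symm (e '' A)
  rwa [Set.image_image, funext e.symm_apply_apply, Set.image_id'] at this

theorem kolmogorovWidth_image (e : X ≃ₗᵢ[ℂ] Y) (n : ℕ) (A : Set X) :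
    kolmogorovWidth n (e '' A) = kolmogorovWidth n A :=
  image_eq_of_image_le (F := kolmogorovWidth n) (kolmogorovWidth_image_le · n ·) e A

theorem linearWidth_image (e : X ≃ₗᵢ[ℂ] Y) (n : ℕ) (A : Set X) :
    linearWidth n (e '' A) = linearWidth n A :=
  image_eq_of_image_le (F := linearWidth n) (linearWidth_image_le · n ·) e A

theorem gelfandWidth_image (e : X ≃ₗᵢ[ℂ] Y) (n : ℕ) (A : Set X) :
    gelfandWidth n (e '' A) = gelfandWidth n A :=
  image_eq_of_image_le (F := gelfandWidth n) (gelfandWidth_image_le · n ·) e A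

theorem gelfandWidthAll_image (e : X ≃ₗᵢ[ℂ] Y) (n : ℕ) (A : Set X) :
    gelfandWidthAll n (e '' A) = gelfandWidthAll n A :=
  image_eq_of_image_le (F := gelfandWidthAll n) (gelfandWidthAll_image_le · n ·) e A

theorem bernsteinWidth_image (e : X ≃ₗᵢ[ℂ] Y) (n : ℕ) (A : Set X) :
    bernsteinWidth n (e '' A) = bernsteinWidth n A := by
  refine le_antisymm ?_ (le_bernsteinWidth_image e n A)
  have := le_bernsteinWidth_image e.symm n (e '' A)
  rwa [Set.image_image, funext e.symm_apply_apply, Set.image_id'] at this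

end Widths

/-! ### Spherical harmonics in complex coordinates -/

section Polynomials

open MvPolynomial

/-- The change of variables `x_k = (z_k + conj z_k) / 2`, `y_k = (z_k - conj z_k) / (2 i)` on
polynomials. -/
def toComplexCoord (d : ℕ) : MvPolynomial (Fin (d * 2)) ℂ →ₐ[ℂ] MvPolynomial (Fin d ⊕ Fin d) ℂ :=
  aeval fun j =>
    ![C (1 / 2) * (X (Sum.inl (finProdFinEquiv.symm j).1) + X (Sum.inr (finProdFinEquiv.symm j).1)),
      C (-Complex.I / 2) *
        (X (Sum.inl (finProdFinEquiv.symm j).1) - X (Sum.inr (finProdFinEquiv.symm j).1))]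
      (finProdFinEquiv.symm j).2

/-- The change of variables `z_k = x_k + i y_k`, `conj z_k = x_k - i y_k` on polynomials. -/
def toRealCoord (d : ℕ) : MvPolynomial (Fin d ⊕ Fin d) ℂ →ₐ[ℂ] MvPolynomial (Fin (d * 2)) ℂ :=
  aeval <| Sum.elim
    (fun k => X (finProdFinEquiv (k, 0)) + C Complex.I * X (finProdFinEquiv (k, 1)))
    (fun k => X (finProdFinEquiv (k, 0)) - C Complex.I * X (finProdFinEquiv (k, 1)))

theorem toComplexCoord_X_zero {d : ℕ} (k : Fin d) :
    toComplexCoord d (X (finProdFinEquiv (k, 0))) = C (1 / 2) * (X (Sum.inl k) + X (Sum.inr k)) := by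
  simp [toComplexCoord, -finProdFinEquiv_symm_apply, -finProdFinEquiv_apply_val]

theorem toComplexCoord_X_one {d : ℕ} (k : Fin d) :
    toComplexCoord d (X (finProdFinEquiv (k, 1))) =
      C (-Complex.I / 2) * (X (Sum.inl k) - X (Sum.inr k)) := by
  simp [toComplexCoord, -finProdFinEquiv_symm_apply, -finProdFinEquiv_apply_val]

theorem toRealCoord_X_inl {d : ℕ} (k : Fin d) : toRealCoord d (X (Sum.inl k)) =
    X (finProdFinEquiv (k, 0)) + C Complex.I * X (finProdFinEquiv (k, 1)) := by
  simp [toRealCoord]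

theorem toRealCoord_X_inr {d : ℕ} (k : Fin d) : toRealCoord d (X (Sum.inr k)) =
    X (finProdFinEquiv (k, 0)) - C Complex.I * X (finProdFinEquiv (k, 1)) := by
  simp [toRealCoord]

theorem C_half_add_C_half {s : Type*} : (C (1 / 2) + C (1 / 2) : MvPolynomial s ℂ) = 1 := by
  rw [← C_add, add_halves, C_1]

theorem C_I_mul_C_I_half {s : Type*} :
    (C Complex.I * C (-Complex.I / 2) : MvPolynomial s ℂ) = C (1 / 2) := by
  rw [← C_mul]
  congr 1
  linear_combination (-1 / 2) * Complex.I_mul_I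

theorem toRealCoord_toComplexCoord (d : ℕ) (P : MvPolynomial (Fin (d * 2)) ℂ) :
    toRealCoord d (toComplexCoord d P) = P := by
  suffices h : (toRealCoord d).comp (toComplexCoord d) = AlgHom.id ℂ _ from DFunLike.congr_fun h P
  ext1 j
  obtain ⟨⟨k, b⟩, rfl⟩ := finProdFinEquiv.surjective j
  have h1 := C_half_add_C_half (s := Fin (d * 2))
  have h2 := C_I_mul_C_I_half (s := Fin (d * 2))
  fin_cases b
  · change toRealCoord d (toComplexCoord d (X (finProdFinEquiv (k, 0)))) =
      X (finProdFinEquiv (k, 0))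
    rw [toComplexCoord_X_zero]
    simp only [map_mul, map_add, toRealCoord_X_inl, toRealCoord_X_inr, algHom_C,
      algebraMap_eq]
    linear_combination X (finProdFinEquiv (k, 0)) * h1
  · change toRealCoord d (toComplexCoord d (X (finProdFinEquiv (k, 1)))) =
      X (finProdFinEquiv (k, 1))
    rw [toComplexCoord_X_one]
    simp only [map_mul, map_sub, toRealCoord_X_inl, toRealCoord_X_inr, algHom_C,
      algebraMap_eq]
    linear_combination X (finProdFinEquiv (k, 1)) * (h1 + 2 * h2)

theorem toComplexCoord_toRealCoord (d : ℕ) (Q : MvPolynomial (Fin d ⊕ Fin d) ℂ) :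
    toComplexCoord d (toRealCoord d Q) = Q := by
  suffices h : (toComplexCoord d).comp (toRealCoord d) = AlgHom.id ℂ _ from DFunLike.congr_fun h Q
  have h1 := C_half_add_C_half (s := Fin d ⊕ Fin d)
  have h2 := C_I_mul_C_I_half (s := Fin d ⊕ Fin d)
  ext1 (k | k)
  · rw [AlgHom.comp_apply, toRealCoord_X_inl]
    simp only [map_mul, map_add, toComplexCoord_X_zero, toComplexCoord_X_one, algHom_C,
      algebraMap_eq, AlgHom.id_apply]
    linear_combination X (Sum.inl k) * h1 + (X (Sum.inl k) - X (Sum.inr k)) * h2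
  · rw [AlgHom.comp_apply, toRealCoord_X_inr]
    simp only [map_mul, map_sub, toComplexCoord_X_zero, toComplexCoord_X_one, algHom_C,
      algebraMap_eq, AlgHom.id_apply]
    linear_combination X (Sum.inr k) * h1 - (X (Sum.inl k) - X (Sum.inr k)) * h2

theorem realRestrict_upsilon {d : ℕ} (P : MvPolynomial (Fin (d * 2)) ℂ) (z : CSphere d) :
    realRestrict (d * 2) P (upsilon d z) = complexRestrict d (toComplexCoord d P) z := by
  induction P using MvPolynomial.induction_on with
  | C a => simp [algHom_C]
  | add P Q hP hQ => simp [hP, hQ]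
  | mul_X P j hP =>
    rw [map_mul, map_mul, map_mul, ContinuousMap.mul_apply, ContinuousMap.mul_apply, hP]
    congr 1
    obtain ⟨⟨k, b⟩, rfl⟩ := finProdFinEquiv.surjective j
    fin_cases b
    · change realRestrict (d * 2) (X (finProdFinEquiv (k, 0))) (upsilon d z) =
        complexRestrict d (toComplexCoord d (X (finProdFinEquiv (k, 0)))) z
      rw [toComplexCoord_X_zero]
      simp [realRestrict, complexRestrict, algHom_C, upsilon, upsilonBar, Complex.re_eq_add_conj,
        -finProdFinEquiv_symm_apply, -finProdFinEquiv_apply_val]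
      ring
    · change realRestrict (d * 2) (X (finProdFinEquiv (k, 1))) (upsilon d z) =
        complexRestrict d (toComplexCoord d (X (finProdFinEquiv (k, 1)))) z
      rw [toComplexCoord_X_one]
      simp [realRestrict, complexRestrict, algHom_C, upsilon, upsilonBar, Complex.im_eq_sub_conj,
        -finProdFinEquiv_symm_apply, -finProdFinEquiv_apply_val]
      field_simp
      simp

/-- Chain rule: `∂/∂z_k = (∂/∂x_k - i ∂/∂y_k) / 2`. -/
theorem pderiv_inl_toComplexCoord {d : ℕ} (k : Fin d) (P : MvPolynomial (Fin (d * 2)) ℂ) :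
    pderiv (Sum.inl k) (toComplexCoord d P) = toComplexCoord d (C (1 / 2) *
      pderiv (finProdFinEquiv (k, 0)) P + C (-Complex.I / 2) * pderiv (finProdFinEquiv (k, 1)) P) := by
  induction P using MvPolynomial.induction_on with
  | C a => simp [algHom_C]
  | add P Q hP hQ => simp only [map_add, hP, hQ, mul_add]; ring
  | mul_X P j hP =>
    obtain ⟨⟨l, b⟩, rfl⟩ := finProdFinEquiv.surjective j
    simp only [map_mul, Derivation.leibniz, smul_eq_mul, hP, map_add, algHom_C]
    fin_cases b <;> by_cases h : l = k <;>
    simp [toComplexCoord_X_zero, toComplexCoord_X_one, pderiv_X, h,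
      Derivation.leibniz, -finProdFinEquiv_apply_val] <;> ring

/-- Chain rule: `∂/∂(conj z_k) = (∂/∂x_k + i ∂/∂y_k) / 2`. -/
theorem pderiv_inr_toComplexCoord {d : ℕ} (k : Fin d) (P : MvPolynomial (Fin (d * 2)) ℂ) :
    pderiv (Sum.inr k) (toComplexCoord d P) = toComplexCoord d (C (1 / 2) *
      pderiv (finProdFinEquiv (k, 0)) P - C (-Complex.I / 2) * pderiv (finProdFinEquiv (k, 1)) P) := by
  induction P using MvPolynomial.induction_on with
  | C a => simp [algHom_C]
  | add P Q hP hQ => simp only [map_add, map_sub, hP, hQ, mul_add]; ring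
  | mul_X P j hP =>
    obtain ⟨⟨l, b⟩, rfl⟩ := finProdFinEquiv.surjective j
    simp only [map_mul, Derivation.leibniz, smul_eq_mul, hP, map_add, map_sub, algHom_C]
    fin_cases b <;> by_cases h : l = k <;>
    simp [toComplexCoord_X_zero, toComplexCoord_X_one, pderiv_X, h,
      Derivation.leibniz, -finProdFinEquiv_apply_val] <;> ring

theorem pderiv_comm {s : Type*} (i j : s) (P : MvPolynomial s ℂ) :
    pderiv i (pderiv j P) = pderiv j (pderiv i P) := by
  classical
  ext e
  by_cases h : i = j
  · rw [h]
  · simp [coeff_pderiv, add_right_comm, h, Ne.symm h]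
    ring

theorem complexLaplacian_toComplexCoord {d : ℕ} (P : MvPolynomial (Fin (d * 2)) ℂ) :
    complexLaplacian d (toComplexCoord d P) = toComplexCoord d (realLaplacian (d * 2) P) := by
  simp only [complexLaplacian, realLaplacian, LinearMap.smul_apply, LinearMap.sum_apply,
    LinearMap.comp_apply, Derivation.coeFn_coe, map_sum]
  rw [← finProdFinEquiv.sum_comp, Fintype.sum_prod_type, Finset.smul_sum]
  refine Finset.sum_congr rfl fun k _ => ?_
  rw [pderiv_inr_toComplexCoord, pderiv_inl_toComplexCoord, Fin.sum_univ_two, ← map_add,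
    ← map_smul]
  congr 1
  simp only [map_sub, pderiv_C_mul, smul_eq_C_mul, pderiv_comm (finProdFinEquiv (k, (1 : Fin 2)))
    (finProdFinEquiv (k, (0 : Fin 2)))]
  have h1 : (C 4 * (C (1 / 2) * C (1 / 2)) : MvPolynomial (Fin (d * 2)) ℂ) = 1 := by
    rw [← C_mul, ← C_mul, ← C_1]; norm_num
  have h2 : (C 4 * (C (-Complex.I / 2) * C (-Complex.I / 2)) : MvPolynomial (Fin (d * 2)) ℂ) =
      -1 := by
    rw [← C_mul, ← C_mul, ← C_1, ← C_neg]
    congr 1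
    linear_combination Complex.I_mul_I
  linear_combination pderiv (finProdFinEquiv (k, 0)) (pderiv (finProdFinEquiv (k, 0)) P) * h1 -
    pderiv (finProdFinEquiv (k, 1)) (pderiv (finProdFinEquiv (k, 1)) P) * h2

theorem realLaplacian_toRealCoord {d : ℕ} (Q : MvPolynomial (Fin d ⊕ Fin d) ℂ) :
    realLaplacian (d * 2) (toRealCoord d Q) = toRealCoord d (complexLaplacian d Q) := by
  rw [← toRealCoord_toComplexCoord d (realLaplacian _ _), ← complexLaplacian_toComplexCoord,
    toComplexCoord_toRealCoord]

theorem isHomogeneous_toComplexCoord {d k : ℕ} {P : MvPolynomial (Fin (d * 2)) ℂ}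
    (hP : P.IsHomogeneous k) : (toComplexCoord d P).IsHomogeneous k := by
  have := hP.aeval (n := 1) (S := ℂ) (fun j => toComplexCoord d (X j)) fun j => by
    obtain ⟨⟨l, b⟩, rfl⟩ := finProdFinEquiv.surjective j
    fin_cases b
    · change IsHomogeneous (toComplexCoord d (X (finProdFinEquiv (l, 0)))) 1
      rw [toComplexCoord_X_zero]
      exact ((isHomogeneous_X _ _).add (isHomogeneous_X _ _)).C_mul _
    · change IsHomogeneous (toComplexCoord d (X (finProdFinEquiv (l, 1)))) 1
      rw [toComplexCoord_X_one]
      exact ((isHomogeneous_X _ _).sub (isHomogeneous_X _ _)).C_mul _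
  rw [aeval_unique (toComplexCoord d)]
  simpa only [mul_one, one_mul, Function.comp_def] using this

theorem isHomogeneous_toRealCoord {d k : ℕ} {Q : MvPolynomial (Fin d ⊕ Fin d) ℂ}
    (hQ : Q.IsHomogeneous k) : (toRealCoord d Q).IsHomogeneous k := by
  have := hQ.aeval (n := 1) (S := ℂ) (fun j => toRealCoord d (X j)) fun j => by
    rcases j with l | l
    · rw [toRealCoord_X_inl]
      exact (isHomogeneous_X _ _).add ((isHomogeneous_X _ _).C_mul _)
    · rw [toRealCoord_X_inr]
      exact (isHomogeneous_X _ _).sub ((isHomogeneous_X _ _).C_mul _)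
  rw [aeval_unique (toRealCoord d)]
  simpa only [mul_one, one_mul, Function.comp_def] using this

/-- The degrees in `z` and in `conj z` of a monomial add up to its degree. -/
theorem weight_inl_add_weight_inr {d : ℕ} (e : Fin d ⊕ Fin d →₀ ℕ) :
    Finsupp.weight (Sum.elim (fun _ => 1) (fun _ => 0) : Fin d ⊕ Fin d → ℕ) e +
      Finsupp.weight (Sum.elim (fun _ => 0) (fun _ => 1) : Fin d ⊕ Fin d → ℕ) e =
      Finsupp.weight (1 : Fin d ⊕ Fin d → ℕ) e := by
  simp [Finsupp.weight_apply, Finsupp.sum_fintype]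

theorem isHomogeneous_of_mem_bihomogeneous {d m n : ℕ} {Q : MvPolynomial (Fin d ⊕ Fin d) ℂ}
    (hQ : Q ∈ bihomogeneous d m n) : Q.IsHomogeneous (m + n) := fun e he => by
  rw [← weight_inl_add_weight_inr, hQ.1 he, hQ.2 he]

theorem weightedHomogeneousComponent_mem_bihomogeneous {d k m n : ℕ} (hmn : m + n = k)
    {Q : MvPolynomial (Fin d ⊕ Fin d) ℂ} (hQ : Q.IsHomogeneous k) :
    weightedHomogeneousComponent (Sum.elim (fun _ => 1) (fun _ => 0) : Fin d ⊕ Fin d → ℕ) m Q ∈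
      bihomogeneous d m n := by
  refine ⟨weightedHomogeneousComponent_mem _ _ _, fun e he => ?_⟩
  rw [coeff_weightedHomogeneousComponent] at he
  split_ifs at he with h
  · have h1 := hQ he
    rw [← weight_inl_add_weight_inr, h] at h1
    omega
  · exact absurd rfl he

theorem coeff_complexLaplacian {d : ℕ} (Q : MvPolynomial (Fin d ⊕ Fin d) ℂ)
    (e : Fin d ⊕ Fin d →₀ ℕ) : coeff e (complexLaplacian d Q) = 4 * ∑ j : Fin d,
      coeff (e + Finsupp.single (Sum.inl j) 1 + Finsupp.single (Sum.inr j) 1) Q *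
        (e (Sum.inr j) + 1) * (e (Sum.inl j) + 1) := by
  simp [complexLaplacian, coeff_sum, coeff_pderiv]

/-- The complex Laplacian lowers the degree in `z` by exactly one, so it acts on each component
of fixed degree in `z` separately. -/
theorem complexLaplacian_weightedHomogeneousComponent {d : ℕ} (m : ℕ)
    {Q : MvPolynomial (Fin d ⊕ Fin d) ℂ} (hQ : complexLaplacian d Q = 0) :
    complexLaplacian d (weightedHomogeneousComponent
      (Sum.elim (fun _ => 1) (fun _ => 0) : Fin d ⊕ Fin d → ℕ) m Q) = 0 := by
  ext e
  have he := congr_arg (coeff e) hQ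
  rw [coeff_complexLaplacian] at he ⊢
  by_cases h : Finsupp.weight (Sum.elim (fun _ => 1) (fun _ => 0) : Fin d ⊕ Fin d → ℕ) e + 1 = m
  · simpa [coeff_weightedHomogeneousComponent, Finsupp.weight_single, h] using he
  · simp [coeff_weightedHomogeneousComponent, Finsupp.weight_single, h]

/-- A homogeneous polynomial of degree `k` is the sum of its components of degree `m ≤ k`
in `z`. -/
theorem sum_weightedHomogeneousComponent_inl {d k : ℕ} {Q : MvPolynomial (Fin d ⊕ Fin d) ℂ}
    (hQ : Q.IsHomogeneous k) : ∑ mn ∈ Finset.HasAntidiagonal.antidiagonal k, weightedHomogeneousComponent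
      (Sum.elim (fun _ => 1) (fun _ => 0) : Fin d ⊕ Fin d → ℕ) mn.1 Q = Q := by
  rw [Finset.Nat.sum_antidiagonal_eq_sum_range_succ_mk]
  ext e
  simp only [coeff_sum, coeff_weightedHomogeneousComponent, Finset.sum_ite_eq, Finset.mem_range]
  split_ifs with h
  · rfl
  · by_contra h0
    have := hQ (Ne.symm h0)
    rw [← weight_inl_add_weight_inr] at this
    omega

/-- In complex coordinates, the spherical harmonics of degree `k` are the sum of the spaces of
harmonics of bidegree `(m, n)` with `m + n = k`. -/
theorem map_realHarmonics (d k : ℕ) :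
    (realHarmonics (d * 2) k).map
        ((upsilon d : C(CSphere d, RSphere (d * 2))).compStarAlgHom' ℂ ℂ : _ →ₗ[ℂ] _) =
      ⨆ mn ∈ Finset.HasAntidiagonal.antidiagonal k, complexHarmonics d mn := by
  refine le_antisymm ?_ (iSup₂_le ?_)
  · rintro _ ⟨_, ⟨P, ⟨hP, hP0⟩, rfl⟩, rfl⟩
    have hQ := isHomogeneous_toComplexCoord ((mem_homogeneousSubmodule k P).1 hP)
    have hQ0 : complexLaplacian d (toComplexCoord d P) = 0 := by
      rw [complexLaplacian_toComplexCoord, LinearMap.mem_ker.1 hP0, map_zero]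
    have : ((upsilon d : C(CSphere d, RSphere (d * 2))).compStarAlgHom' ℂ ℂ)
        (realRestrict (d * 2) P) = complexRestrict d (toComplexCoord d P) :=
      ContinuousMap.ext (realRestrict_upsilon P)
    change ((upsilon d : C(CSphere d, RSphere (d * 2))).compStarAlgHom' ℂ ℂ)
        (realRestrict (d * 2) P) ∈ _
    rw [this, ← sum_weightedHomogeneousComponent_inl hQ, map_sum]
    refine Submodule.sum_mem _ fun mn hmn => Submodule.mem_iSup_of_mem mn
      (Submodule.mem_iSup_of_mem hmn ⟨_, ⟨?_, ?_⟩, rfl⟩)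
    · exact weightedHomogeneousComponent_mem_bihomogeneous (Finset.HasAntidiagonal.mem_antidiagonal.1 hmn) hQ
    · exact complexLaplacian_weightedHomogeneousComponent mn.1 hQ0
  · rintro mn hmn _ ⟨Q, ⟨hQ, hQ0⟩, rfl⟩
    refine ⟨realRestrict (d * 2) (toRealCoord d Q), ⟨_, ⟨?_, ?_⟩, rfl⟩, ?_⟩
    · rw [← Finset.HasAntidiagonal.mem_antidiagonal.1 hmn]
      exact isHomogeneous_toRealCoord (isHomogeneous_of_mem_bihomogeneous hQ)
    · exact LinearMap.mem_ker.2
        (by rw [realLaplacian_toRealCoord, LinearMap.mem_ker.1 hQ0, map_zero])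
    · refine ContinuousMap.ext fun z => (realRestrict_upsilon _ z).trans ?_
      rw [toComplexCoord_toRealCoord]
      rfl

end Polynomials

/-! ### Transport along the homeomorphism of the two spheres -/

section Transport

/-- The isometric isomorphism `f ↦ f ∘ Υ⁻¹` of `L^p(Ω_d)` onto `L^p(S^{2d-1})`. -/
def lpUpsilon (d : ℕ) (p : ℝ≥0∞) [Fact (1 ≤ p)] : Lp ℂ p (σ d) ≃ₗᵢ[ℂ] Lp ℂ p (τ (d * 2)) where
  __ := Lp.compMeasurePreservingₗᵢ ℂ (upsilon d).symm (measurePreserving_upsilon_symm d)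
  invFun := Lp.compMeasurePreserving (upsilon d) (measurePreserving_upsilon d)
  left_inv f := by
    change Lp.compMeasurePreserving _ _ (Lp.compMeasurePreserving _ _ f) = f
    rw [← Lp.compMeasurePreserving_comp_apply]
    convert Lp.compMeasurePreserving_id_apply f
    exact (upsilon d).symm_comp_self
  right_inv f := by
    change Lp.compMeasurePreserving _ _ (Lp.compMeasurePreserving _ _ f) = f
    rw [← Lp.compMeasurePreserving_comp_apply]
    convert Lp.compMeasurePreserving_id_apply f
    exact (upsilon d).self_comp_symm

theorem integral_mul_conj_upsilon {d : ℕ} {p : ℝ≥0∞} [Fact (1 ≤ p)] (f : Lp ℂ p (σ d))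
    (Y : C(RSphere (d * 2), ℂ)) :
    ∫ x, lpUpsilon d p f x * starRingEnd ℂ (Y x) ∂τ (d * 2) =
      ∫ z, f z * starRingEnd ℂ (Y (upsilon d z)) ∂σ d := by
  rw [← (measurePreserving_upsilon_symm d).integral_comp
    (upsilon d).symm.measurableEmbedding]
  refine integral_congr_ae ?_
  filter_upwards [Lp.coeFn_compMeasurePreserving f (measurePreserving_upsilon_symm d)] with x hx
  change Lp.compMeasurePreserving _ _ f x * _ = _
  rw [hx, Function.comp_apply, (upsilon d).apply_symm_apply]

/-- The two multiplier relations correspond: the relation for all `(m, n)` with `m + n = k` says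
that the sum of the `𝓗_{m,n}`, which is `𝓗_k ∘ Υ`, lies in one test space. -/
theorem isMultiplierImage_lpUpsilon_iff {d : ℕ} (lam : ℝ≥0 → ℂ) {p q : ℝ≥0∞} [hp : Fact (1 ≤ p)]
    [hq : Fact (1 ≤ q)] (φ : Lp ℂ p (σ d)) (f : Lp ℂ q (σ d)) :
    IsMultiplierImage (τ (d * 2)) (realHarmonics (d * 2)) (lamReal lam) p q
        (lpUpsilon d p φ) (lpUpsilon d q f) ↔
      IsMultiplierImage (σ d) (complexHarmonics d) (lamStar lam) p q φ f := by
  rw [isMultiplierImage_iff_le_testSubmodule, isMultiplierImage_iff_le_testSubmodule]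
  have key (k : ℕ) : realHarmonics (d * 2) k ≤ testSubmodule (lamReal lam k)
        ((Lp.memLp (lpUpsilon d p φ)).integrable hp.out)
        ((Lp.memLp (lpUpsilon d q f)).integrable hq.out) ↔
      (realHarmonics (d * 2) k).map
          ((upsilon d : C(CSphere d, RSphere (d * 2))).compStarAlgHom' ℂ ℂ : _ →ₗ[ℂ] _) ≤
        testSubmodule (lamReal lam k) ((Lp.memLp φ).integrable hp.out)
          ((Lp.memLp f).integrable hq.out) := by
    rw [Submodule.map_le_iff_le_comap]
    refine forall₂_congr fun Y _ => ?_
    change _ = _ ↔ _ = _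
    rw [integral_mul_conj_upsilon, integral_mul_conj_upsilon]
    rfl
  simp only [key, map_realHarmonics, iSup_le_iff, Finset.HasAntidiagonal.mem_antidiagonal]
  constructor
  · rintro h ⟨m, n⟩
    exact h _ _ rfl
  · rintro h _ ⟨m, n⟩ rfl
    exact h (m, n)

theorem image_complexMultiplierBall (d : ℕ) (lam : ℝ≥0 → ℂ) (p q : ℝ≥0∞) [Fact (1 ≤ p)]
    [Fact (1 ≤ q)] :
    lpUpsilon d q '' complexMultiplierBall d lam p q = realMultiplierBall d lam p q := by
  ext g
  constructor
  · rintro ⟨f, ⟨φ, hφ, h⟩, rfl⟩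
    exact ⟨lpUpsilon d p φ, by rwa [LinearIsometryEquiv.norm_map],
      (isMultiplierImage_lpUpsilon_iff lam φ f).2 h⟩
  · rintro ⟨ψ, hψ, h⟩
    obtain ⟨φ, rfl⟩ := (lpUpsilon d p).surjective ψ
    obtain ⟨f, rfl⟩ := (lpUpsilon d q).surjective g
    exact ⟨f, ⟨φ, by rwa [LinearIsometryEquiv.norm_map] at hψ,
      (isMultiplierImage_lpUpsilon_iff lam φ f).1 h⟩, rfl⟩

end Transport

end SphereWidths

end

theorem mainTheorem5 (d : ℕ) (hd : 1 ≤ d) (lam : ℝ≥0 → ℂ) (hlam : ∃ C : ℝ, ∀ t, ‖lam t‖ ≤ C)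
    (p q : ℝ≥0∞) [Fact (1 ≤ p)] [Fact (1 ≤ q)]
    (hbdd : IsBoundedMultiplier (σ d) (complexHarmonics d) (lamStar lam) p q) :
    IsBoundedMultiplier (τ (d * 2)) (realHarmonics (d * 2)) (lamReal lam) p q ∧
    (∀ (φ : Lp ℂ p (σ d)) (g : Lp ℂ q (τ (d * 2))),
      IsMultiplierImage (σ d) (complexHarmonics d) (lamStar lam) p q φ
          (Lp.compMeasurePreserving (upsilon d) (measurePreserving_upsilon d) g) ↔
        IsMultiplierImage (τ (d * 2)) (realHarmonics (d * 2)) (lamReal lam) p q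
          (Lp.compMeasurePreserving (upsilon d).symm (measurePreserving_upsilon_symm d) φ) g) ∧
    ∀ n : ℕ,
      kolmogorovWidth n (complexMultiplierBall d lam p q) =
        kolmogorovWidth n (realMultiplierBall d lam p q) ∧
      gelfandWidth n (complexMultiplierBall d lam p q) =
        gelfandWidth n (realMultiplierBall d lam p q) ∧
      gelfandWidthAll n (complexMultiplierBall d lam p q) =
        gelfandWidthAll n (realMultiplierBall d lam p q) ∧
      linearWidth n (complexMultiplierBall d lam p q) =
        linearWidth n (realMultiplierBall d lam p q) ∧
      bernsteinWidth n (complexMultiplierBall d lam p q) =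
        bernsteinWidth n (realMultiplierBall d lam p q) := by
  refine ⟨⟨fun ψ => ?_, ?_⟩, fun φ g => ?_, fun n => ?_⟩
  · obtain ⟨φ, rfl⟩ := (lpUpsilon d p).surjective ψ
    obtain ⟨f, hf⟩ := hbdd.1 φ
    exact ⟨lpUpsilon d q f, (isMultiplierImage_lpUpsilon_iff lam φ f).2 hf⟩
  · have h := image_complexMultiplierBall d lam p q
    rw [complexMultiplierBall, realMultiplierBall] at h
    rw [← h, Set.image_image]
    simpa only [LinearIsometryEquiv.norm_map] using hbdd.2
  · have h := isMultiplierImage_lpUpsilon_iff lam φ ((lpUpsilon d q).symm g)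
    rw [LinearIsometryEquiv.apply_symm_apply] at h
    exact h.symm
  · rw [← image_complexMultiplierBall, kolmogorovWidth_image, gelfandWidth_image,
      gelfandWidthAll_image, linearWidth_image, bernsteinWidth_image]
    exact ⟨rfl, rfl, rfl, rfl, rfl⟩
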